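/- For real $\alpha>0$, $\beta>0$ and $x\in\mathbb{C}$ with $|x|=1$, let $A_m(\alpha,\beta,x)$, $m\ge 0$, be the Maclaurin coefficients given by $$\frac{(1+xz)^\alpha}{(1-z)^\beta}=\sum_{m=0}^\infty A_m(\alpha,\beta,x)\,z^m,\qquad |z|<1,$$ with principal branches of the powers, and write $A_m(\alpha,x)=A_m(\alpha,1,x)$. Then for every $x\in\mathbb{C}$ with $|x|=1$, every $\alpha\in(0,1)$ and every integer $n\ge 1$, the number $A_{2n-1}(\alpha,1)$ is real and $$A_{2n-1}(\alpha,1)\ \ge\ |A_{2n-1}(\alpha,x)|.$$ -/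

import Mathlib

/-- The function `z ↦ (1 + x z)^α / (1 - z)^β`, with principal powers. For `‖x‖ = 1` and `‖z‖ < 1`
both bases lie in the right half-plane, so it is holomorphic on the open unit disc. -/
noncomputable def brannanFun (α β : ℝ) (x z : ℂ) : ℂ :=
  (1 + x * z) ^ (α : ℂ) / (1 - z) ^ (β : ℂ)

/-- The Maclaurin coefficient `A_n(α, β, x)`, that is, the coefficient of `z^n` in the expansion of
`(1 + x z)^α / (1 - z)^β` at `z = 0`. -/
noncomputable def brannanCoeff (n : ℕ) (α β : ℝ) (x : ℂ) : ℂ :=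
  iteratedDeriv n (brannanFun α β x) 0 / (n.factorial : ℂ)

/-! For `β = 1` the coefficient is a partial sum of the binomial series of `(1 + x)^α`. The omitted
tail has moments of a beta density as coefficients, so for `x ≠ -1` summing geometric series under
the integral gives `(1 + x)^α + (-x)^(p+2) ∫ W(t) t^p / (1 + t x) dt` with `W ≥ 0`
(`brannanCoeff_eq_cpow_add_integral`). At `x = 1` with `p` even both terms are positive.

For general `x`, put `c = ‖1 + x‖ / 2`. The triangle inequality leaves a real inequality in `c` with
equality at `c = 1` (`integral_betaWeight_chord_le`): the loss in `(2c)^α` must pay for the gain in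
the integral. Since `t^p ≤ 1` and `sin(πα)/π ≤ α`, it reduces to `integral_beta_chord_le`. Writing
both sides as integrals over `u` in `[c, 1]` and using Fubini, it is enough to compare derivatives
at each `u`, which is `integral_chordKernel_le`. -/

/-! ### Two closed-form integrals. -/

/-- For `x` on the unit circle with `‖1 + x‖ = 2 u`, this is `‖1 + t x‖ ^ 2`. -/
def chordSq (u t : ℝ) : ℝ := (1 - t) ^ 2 + 4 * t * u ^ 2

theorem chordSq_pos {u t : ℝ} (hu : 0 < u) (ht : 0 ≤ t) : 0 < chordSq u t := by
  unfold chordSq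
  rcases ht.eq_or_lt with rfl | ht
  · norm_num
  · positivity

theorem chordSq_one_left (t : ℝ) : chordSq 1 t = (1 + t) ^ 2 := by
  unfold chordSq; ring

theorem sqrt_chordSq_zero (u : ℝ) : √(chordSq u 0) = 1 := by
  simp [chordSq]

theorem sqrt_chordSq_one {u : ℝ} (hu : 0 < u) : √(chordSq u 1) = 2 * u := by
  rw [show chordSq u 1 = (2 * u) ^ 2 by unfold chordSq; ring]
  exact Real.sqrt_sq (by positivity)

theorem continuous_chordSq_uncurry : Continuous fun p : ℝ × ℝ ↦ chordSq p.1 p.2 := by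
  unfold chordSq; fun_prop

theorem continuous_chordSq (u : ℝ) : Continuous (chordSq u) := by
  unfold chordSq; fun_prop

theorem hasDerivAt_linear_div_sqrt_chordSq (a b : ℝ) {u t : ℝ} (hu : 0 < u) (ht : 0 ≤ t) :
    HasDerivAt (fun t ↦ (a * t + b) / √(chordSq u t))
      ((a * chordSq u t - (a * t + b) * (t - (1 - 2 * u ^ 2))) /
        (chordSq u t * √(chordSq u t))) t := by
  have hD := chordSq_pos hu ht
  have hs := Real.sqrt_pos.2 hD
  have h1 : HasDerivAt (chordSq u) (2 * (t - (1 - 2 * u ^ 2))) t := by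
    have h := (((hasDerivAt_id t).const_sub 1).pow 2).add
      (((hasDerivAt_id t).const_mul 4).mul_const (u ^ 2))
    refine (h.congr_deriv ?_)
    simp only [id]
    ring
  have h2 : HasDerivAt (fun t ↦ a * t + b) a t := by
    simpa using ((hasDerivAt_id t).const_mul a).add_const b
  refine (h2.div (h1.sqrt hD.ne') hs.ne').congr_deriv ?_
  have hsq := Real.sq_sqrt hD.le
  field_simp
  rw [hsq]
  ring

theorem integral_linear_chordSq (a b : ℝ) {u : ℝ} (hu : 0 < u) :
    ∫ t in (0 : ℝ)..1, (a * chordSq u t - (a * t + b) * (t - (1 - 2 * u ^ 2))) /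
        (chordSq u t * √(chordSq u t)) = (a + b) / (2 * u) - b := by
  rw [intervalIntegral.integral_eq_sub_of_hasDerivAt
    (f := fun t ↦ (a * t + b) / √(chordSq u t))]
  · simp [sqrt_chordSq_zero, sqrt_chordSq_one hu]
  · intro t ht
    rw [Set.uIcc_of_le zero_le_one] at ht
    exact hasDerivAt_linear_div_sqrt_chordSq a b hu ht.1
  · refine ContinuousOn.intervalIntegrable ?_
    rw [Set.uIcc_of_le zero_le_one]
    have hc := continuous_chordSq u
    refine ContinuousOn.div (by fun_prop) (by fun_prop) fun t ht ↦ ?_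
    have := chordSq_pos hu ht.1
    positivity

theorem integral_mul_chordSq {u : ℝ} (hu : 0 < u) (hu1 : u < 1) :
    ∫ t in (0 : ℝ)..1, 4 * t * u / (chordSq u t * √(chordSq u t)) = 1 / (u * (1 + u)) := by
  have h0 : 1 - u ≠ 0 := by linarith
  have h1 : 1 + u ≠ 0 := by linarith
  -- With `m = 1 - 2u²`, the numerator in `integral_linear_chordSq` is `-(a m + b) t + (a + b m)`;
  -- matching it with `4 u t` fixes `a` and `b`, using `1 - m² = 4u²(1 - u²)`.
  have h := integral_linear_chordSq ((1 - 2 * u ^ 2) / (u * (1 - u) * (1 + u)))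
    (-1 / (u * (1 - u) * (1 + u))) hu
  convert h using 1
  · refine intervalIntegral.integral_congr fun t _ ↦ ?_
    congr 1
    unfold chordSq
    field_simp
    ring
  · field_simp
    ring

theorem integral_one_sub_chordSq {u : ℝ} (hu : 0 < u) (hu1 : u < 1) :
    ∫ t in (0 : ℝ)..1, 2 * (1 - t) / (chordSq u t * √(chordSq u t)) = 1 / (u * (1 + u)) := by
  have h0 : 1 - u ≠ 0 := by linarith
  have h1 : 1 + u ≠ 0 := by linarith
  have h := integral_linear_chordSq (1 / ((1 - u) * (1 + u))) (1 / ((1 - u) * (1 + u))) hu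
  convert h using 1
  · refine intervalIntegral.integral_congr fun t _ ↦ ?_
    congr 1
    unfold chordSq
    field_simp
    ring
  · field_simp
    ring

/-! ### The derivative estimate and its integration over `u`. -/

/-- The `u`-derivative of `-1 / √(chordSq u t)`, weighted by the beta density. -/
noncomputable def chordKernel (α u t : ℝ) : ℝ :=
  t ^ (1 - α) * (1 - t) ^ α * (4 * t * u / (chordSq u t * √(chordSq u t)))

theorem continuousOn_chordKernel {α c : ℝ} (hα : α ∈ Set.Ioo (0 : ℝ) 1) (hc : 0 < c) :
    ContinuousOn (Function.uncurry (chordKernel α)) (Set.Icc c 1 ×ˢ Set.Icc 0 1) := by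
  have h := continuous_chordSq_uncurry
  have h1 : Continuous fun p : ℝ × ℝ ↦ p.2 ^ (1 - α) :=
    continuous_snd.rpow_const fun _ ↦ Or.inr (by linarith [hα.2])
  have h2 : Continuous fun p : ℝ × ℝ ↦ (1 - p.2) ^ α :=
    (continuous_const.sub continuous_snd).rpow_const fun _ ↦ Or.inr hα.1.le
  unfold chordKernel Function.uncurry
  refine (h1.mul h2).continuousOn.mul (ContinuousOn.div (by fun_prop) (by fun_prop) ?_)
  rintro ⟨u, t⟩ ⟨hu, ht⟩
  have := chordSq_pos (hc.trans_le hu.1) ht.1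
  positivity

theorem continuousOn_chordKernel_right {α u : ℝ} (hα : α ∈ Set.Ioo (0 : ℝ) 1)
    (hu : u ∈ Set.Ioc (0 : ℝ) 1) : ContinuousOn (chordKernel α u) (Set.Icc 0 1) :=
  (continuousOn_chordKernel hα hu.1).comp (f := fun t ↦ (u, t)) (by fun_prop)
    fun _ ht ↦ ⟨⟨le_rfl, hu.2⟩, ht⟩

/-- Concavity of `s ↦ s^α`: the graph lies below its tangent at `s = 2u`. This tangent point makes
the two resulting integrals equal. -/
theorem one_sub_rpow_le {α u t : ℝ} (hα : α ∈ Set.Ioo (0 : ℝ) 1) (hu : 0 < u) (ht : t ≤ 1) :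
    (1 - t) ^ α ≤ (2 * u) ^ α * (1 - α + α * ((1 - t) / (2 * u))) := by
  have h0 : 0 ≤ (1 - t) / (2 * u) := div_nonneg (by linarith) (by positivity)
  have h := rpow_one_add_le_one_add_mul_self (s := (1 - t) / (2 * u) - 1)
    (by linarith) hα.1.le hα.2.le
  calc (1 - t) ^ α = (2 * u * ((1 - t) / (2 * u))) ^ α := by congr 1; field_simp
    _ = (2 * u) ^ α * ((1 - t) / (2 * u)) ^ α := Real.mul_rpow (by positivity) h0
    _ ≤ _ := by
      gcongr
      rw [show 1 + ((1 - t) / (2 * u) - 1) = (1 - t) / (2 * u) by ring] at h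
      linarith

/-- After `t^(1-α) ≤ 1` and the tangent bound, the integrand is dominated by a combination with
weights `1 - α` and `α` of two functions whose integrals are both `1 / (u (1 + u))`, so `α` drops
out of the average. -/
theorem integral_chordKernel_le {α u : ℝ} (hα : α ∈ Set.Ioo (0 : ℝ) 1)
    (hu : u ∈ Set.Ioo (0 : ℝ) 1) :
    ∫ t in (0 : ℝ)..1, chordKernel α u t ≤ 2 ^ α * u ^ (α - 1) := by
  have hu0 := hu.1
  have hα0 := hα.1
  have hα1 := hα.2
  have hc := continuous_chordSq u
  have hne : ∀ t ∈ Set.Icc (0 : ℝ) 1, chordSq u t * √(chordSq u t) ≠ 0 := fun t ht ↦ by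
    have := chordSq_pos hu0 ht.1
    positivity
  have i1 : IntervalIntegrable (fun t ↦ 4 * t * u / (chordSq u t * √(chordSq u t)))
      MeasureTheory.volume 0 1 := by
    refine ContinuousOn.intervalIntegrable ?_
    rw [Set.uIcc_of_le zero_le_one]
    exact ContinuousOn.div (by fun_prop) (by fun_prop) hne
  have i2 : IntervalIntegrable (fun t ↦ 2 * (1 - t) / (chordSq u t * √(chordSq u t)))
      MeasureTheory.volume 0 1 := by
    refine ContinuousOn.intervalIntegrable ?_
    rw [Set.uIcc_of_le zero_le_one]
    exact ContinuousOn.div (by fun_prop) (by fun_prop) hne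
  have key : ∫ t in (0 : ℝ)..1, chordKernel α u t ≤
      ∫ t in (0 : ℝ)..1, (2 * u) ^ α *
        ((1 - α) * (4 * t * u / (chordSq u t * √(chordSq u t))) +
          α * (2 * (1 - t) / (chordSq u t * √(chordSq u t)))) := by
    refine intervalIntegral.integral_mono_on zero_le_one ?_
      (((i1.const_mul _).add (i2.const_mul _)).const_mul _) fun t ht ↦ ?_
    · refine ContinuousOn.intervalIntegrable ?_
      rw [Set.uIcc_of_le zero_le_one]
      exact continuousOn_chordKernel_right hα ⟨hu.1, hu.2.le⟩
    · have hD := chordSq_pos hu0 ht.1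
      have hD' : 0 < chordSq u t * √(chordSq u t) := by positivity
      have ht0 := ht.1
      have ht1 : 0 ≤ 1 - t := by linarith [ht.2]
      unfold chordKernel
      calc t ^ (1 - α) * (1 - t) ^ α * (4 * t * u / (chordSq u t * √(chordSq u t)))
          ≤ 1 * ((2 * u) ^ α * (1 - α + α * ((1 - t) / (2 * u)))) *
            (4 * t * u / (chordSq u t * √(chordSq u t))) := by
            gcongr
            · exact Real.rpow_le_one ht.1 ht.2 (by linarith)
            · exact one_sub_rpow_le hα hu0 ht.2
        _ = (2 * u) ^ α * ((1 - α) * (4 * t * u / (chordSq u t * √(chordSq u t))) +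
          α * (t * (2 * (1 - t) / (chordSq u t * √(chordSq u t))))) := by
            field_simp
            ring
        _ ≤ _ := by
            gcongr
            refine mul_le_of_le_one_left (by positivity) ht.2
  refine key.trans ?_
  rw [intervalIntegral.integral_const_mul, intervalIntegral.integral_add (i1.const_mul _)
    (i2.const_mul _), intervalIntegral.integral_const_mul, intervalIntegral.integral_const_mul,
    integral_mul_chordSq hu0 hu.2, integral_one_sub_chordSq hu0 hu.2, ← add_mul,
    Real.mul_rpow zero_le_two hu0.le, Real.rpow_sub_one hu0.ne']
  have : 1 / (u * (1 + u)) ≤ 1 / u := by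
    gcongr
    nlinarith
  calc _ = 2 ^ α * u ^ α * (1 / (u * (1 + u))) := by ring
    _ ≤ 2 ^ α * u ^ α * (1 / u) := by gcongr
    _ = _ := by ring

theorem integral_chordKernel_left {α c t : ℝ} (hc : c ∈ Set.Ioc (0 : ℝ) 1) (ht : 0 ≤ t) :
    ∫ u in c..1, chordKernel α u t =
      t ^ (1 - α) * (1 - t) ^ α * ((√(chordSq c t))⁻¹ - (1 + t)⁻¹) := by
  have hd : ∀ u : ℝ, 0 < u → HasDerivAt (fun u ↦ -(√(chordSq u t))⁻¹)
      (4 * t * u / (chordSq u t * √(chordSq u t))) u := fun u hu ↦ by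
    have hD := chordSq_pos hu ht
    have hs := Real.sqrt_pos.2 hD
    have h1 : HasDerivAt (fun u ↦ chordSq u t) (8 * t * u) u := by
      refine ((((hasDerivAt_id u).pow 2).const_mul (4 * t)).const_add ((1 - t) ^ 2)).congr_deriv ?_
      simp only [id]
      ring
    refine (((h1.sqrt hD.ne').inv hs.ne').neg).congr_deriv ?_
    have hsq := Real.sq_sqrt hD.le
    field_simp
    rw [hsq]
    ring
  unfold chordKernel
  rw [intervalIntegral.integral_const_mul]
  congr 1
  rw [intervalIntegral.integral_eq_sub_of_hasDerivAt (fun u hu ↦ hd u ?_)]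
  · rw [chordSq_one_left, Real.sqrt_sq (by linarith)]
    ring
  · refine ContinuousOn.intervalIntegrable ?_
    rw [Set.uIcc_of_le hc.2]
    have h : Continuous fun u ↦ chordSq u t := by unfold chordSq; fun_prop
    refine ContinuousOn.div (by fun_prop) (by fun_prop) fun u hu ↦ ?_
    have := chordSq_pos (hc.1.trans_le hu.1) ht
    positivity
  · rw [Set.uIcc_of_le hc.2] at hu
    exact hc.1.trans_le hu.1

theorem integral_beta_chord_le {α c : ℝ} (hα : α ∈ Set.Ioo (0 : ℝ) 1)
    (hc : c ∈ Set.Ioc (0 : ℝ) 1) :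
    α * ∫ t in (0 : ℝ)..1, t ^ (1 - α) * (1 - t) ^ α * ((√(chordSq c t))⁻¹ - (1 + t)⁻¹) ≤
      2 ^ α * (1 - c ^ α) := by
  have hint : MeasureTheory.Integrable (Function.uncurry (chordKernel α))
      ((MeasureTheory.volume.restrict (Set.uIoc c 1)).prod
        (MeasureTheory.volume.restrict (Set.uIoc 0 1))) := by
    rw [MeasureTheory.Measure.prod_restrict, Set.uIoc_of_le hc.2, Set.uIoc_of_le zero_le_one]
    exact ((continuousOn_chordKernel hα hc.1).integrableOn_compact
      (isCompact_Icc.prod isCompact_Icc)).mono_set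
        (Set.prod_mono Set.Ioc_subset_Icc_self Set.Ioc_subset_Icc_self)
  have hswap : ∫ u in c..1, ∫ t in (0 : ℝ)..1, chordKernel α u t =
      ∫ t in (0 : ℝ)..1, ∫ u in c..1, chordKernel α u t := by
    simp only [intervalIntegral.integral_of_le hc.2, intervalIntegral.integral_of_le zero_le_one]
    rw [Set.uIoc_of_le hc.2, Set.uIoc_of_le zero_le_one] at hint
    exact MeasureTheory.integral_integral_swap hint
  have hleft : ∫ t in (0 : ℝ)..1, ∫ u in c..1, chordKernel α u t =
      ∫ t in (0 : ℝ)..1, t ^ (1 - α) * (1 - t) ^ α * ((√(chordSq c t))⁻¹ - (1 + t)⁻¹) := by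
    refine intervalIntegral.integral_congr fun t ht ↦ ?_
    rw [Set.uIcc_of_le zero_le_one] at ht
    exact integral_chordKernel_left hc ht.1
  rw [← hleft, ← hswap]
  have hm : ∫ u in c..1, ∫ t in (0 : ℝ)..1, chordKernel α u t ≤
      ∫ u in c..1, 2 ^ α * u ^ (α - 1) := by
    -- The open interval suffices and avoids `u = 1`, where the antiderivatives have a pole in `u`.
    refine intervalIntegral.integral_mono_on_of_le_Ioo hc.2 ?_ ?_ fun u hu ↦
      integral_chordKernel_le hα ⟨hc.1.trans hu.1, hu.2⟩
    · rw [intervalIntegrable_iff, MeasureTheory.IntegrableOn]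
      simp only [intervalIntegral.integral_of_le zero_le_one]
      rw [Set.uIoc_of_le zero_le_one] at hint
      exact hint.integral_prod_left
    · refine ContinuousOn.intervalIntegrable ?_
      rw [Set.uIcc_of_le hc.2]
      exact continuousOn_const.mul (continuousOn_id.rpow_const fun u hu ↦
        Or.inl (hc.1.trans_le hu.1).ne')
  refine (mul_le_mul_of_nonneg_left hm hα.1.le).trans_eq ?_
  rw [intervalIntegral.integral_const_mul, integral_rpow (Or.inl (by linarith [hα.1]))]
  have := hα.1.ne'
  simp only [sub_add_cancel, Real.one_rpow]
  field_simp

/-! ### Binomial coefficients and the binomial series on the circle. -/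

open Filter Topology MeasureTheory

theorem Ring.succ_mul_choose_succ (a : ℝ) (k : ℕ) :
    (k + 1) * Ring.choose a (k + 1) = (a - k) * Ring.choose a k := by
  have h := Ring.descPochhammer_eq_factorial_smul_choose a k
  have h' := Ring.descPochhammer_eq_factorial_smul_choose a (k + 1)
  rw [descPochhammer_succ_right, Polynomial.smeval_mul, h] at h'
  simp only [Polynomial.smeval_sub, Polynomial.smeval_X, Polynomial.smeval_natCast, pow_one,
    nsmul_eq_mul, pow_zero, mul_one, Nat.factorial_succ, Nat.cast_mul, Nat.cast_succ] at h'
  have hk : (k.factorial : ℝ) ≠ 0 := by positivity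
  apply mul_left_cancel₀ hk
  linarith

/-- The absolute value of the binomial coefficient `Ring.choose α k` when `α ∈ (0, 1)`, `k ≥ 1`. -/
noncomputable def absChoose (α : ℝ) (k : ℕ) : ℝ := (-1) ^ (k + 1) * Ring.choose α k

theorem choose_eq_absChoose (α : ℝ) (k : ℕ) :
    Ring.choose α k = (-1) ^ (k + 1) * absChoose α k := by
  rw [absChoose, ← mul_assoc, ← mul_pow]
  simp

theorem succ_mul_absChoose_succ (α : ℝ) (k : ℕ) :
    (k + 1) * absChoose α (k + 1) = (k - α) * absChoose α k := by
  have := Ring.succ_mul_choose_succ α k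
  unfold absChoose
  rw [pow_succ]
  linear_combination (-(-1) ^ (k + 1)) * this

theorem absChoose_one (α : ℝ) : absChoose α 1 = α := by
  simp [absChoose]

theorem absChoose_succ_nonneg {α : ℝ} (hα : α ∈ Set.Ioo (0 : ℝ) 1) (k : ℕ) :
    0 ≤ absChoose α (k + 1) := by
  induction k with
  | zero => simpa [absChoose_one] using hα.1.le
  | succ k ih =>
    have h := succ_mul_absChoose_succ α (k + 1)
    have h1 : 0 ≤ ((k + 1 : ℕ) - α) * absChoose α (k + 1) := by
      refine mul_nonneg ?_ ih
      push_cast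
      linarith [hα.2, (Nat.cast_nonneg k : (0 : ℝ) ≤ k)]
    rw [← h] at h1
    exact nonneg_of_mul_nonneg_right h1 (by positivity)

theorem sum_alternating_choose (α : ℝ) (m : ℕ) :
    ∑ k ∈ Finset.range (m + 1), Ring.choose α k * (-1) ^ k =
      (-1) ^ m * Ring.choose (α - 1) m := by
  induction m with
  | zero => simp
  | succ m ih =>
    rw [Finset.sum_range_succ, ih]
    have h := Ring.choose_succ_succ (α - 1) m
    rw [sub_add_cancel] at h
    rw [h, pow_succ]
    ring

/-- The sum telescopes to the product of the factors `1 - α/j`, each in `[0, 1]`. This gives both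
absolute summability of the coefficients and the case `x = -1`. -/
theorem sum_alternating_choose_mem_Icc {α : ℝ} (hα : α ∈ Set.Ioo (0 : ℝ) 1) (m : ℕ) :
    ∑ k ∈ Finset.range (m + 1), Ring.choose α k * (-1) ^ k ∈ Set.Icc (0 : ℝ) 1 := by
  rw [sum_alternating_choose]
  induction m with
  | zero => simp
  | succ m ih =>
    have h := Ring.succ_mul_choose_succ (α - 1) m
    have h2 : (-1) ^ (m + 1) * Ring.choose (α - 1) (m + 1) =
        (m + 1 - α) / (m + 1) * ((-1) ^ m * Ring.choose (α - 1) m) := by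
      field_simp
      rw [pow_succ]
      linear_combination (-(-1) ^ m) * h
    have hm : (0 : ℝ) ≤ m := m.cast_nonneg
    have h3 : 0 ≤ (m + 1 - α) / (m + 1) := div_nonneg (by linarith [hα.2]) (by positivity)
    have h4 : (m + 1 - α) / (m + 1) ≤ 1 := by
      rw [div_le_one (by positivity)]
      linarith [hα.1]
    rw [h2]
    exact ⟨mul_nonneg h3 ih.1, mul_le_one₀ h4 ih.1 ih.2⟩

theorem summable_absChoose {α : ℝ} (hα : α ∈ Set.Ioo (0 : ℝ) 1) : Summable (absChoose α) := by
  rw [← summable_nat_add_iff 1]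
  refine summable_of_sum_range_le (c := 1) (absChoose_succ_nonneg hα) fun m ↦ ?_
  have h := (sum_alternating_choose_mem_Icc hα m).1
  rw [Finset.sum_range_succ'] at h
  have h2 : ∀ k, Ring.choose α (k + 1) * (-1) ^ (k + 1) = -absChoose α (k + 1) := fun k ↦ by
    rw [absChoose, pow_succ (-1 : ℝ) (k + 1)]
    ring
  simp only [h2, Finset.sum_neg_distrib, Ring.choose_zero_right, pow_zero, mul_one] at h
  linarith

theorem summable_abs_choose {α : ℝ} (hα : α ∈ Set.Ioo (0 : ℝ) 1) :
    Summable fun k ↦ |Ring.choose α k| := by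
  refine (summable_absChoose hα).abs.congr fun k ↦ ?_
  simp [absChoose, abs_mul]

/-- The binomial series converges on the whole unit circle, except possibly at `-1`. -/
theorem hasSum_choose_mul_pow_of_norm_eq_one {α : ℝ} (hα : α ∈ Set.Ioo (0 : ℝ) 1) {x : ℂ}
    (hx : ‖x‖ = 1) (hx1 : 1 + x ∈ Complex.slitPlane) :
    HasSum (fun k ↦ ((Ring.choose α k : ℝ) : ℂ) * x ^ k) ((1 + x) ^ (α : ℂ)) := by
  have hbound : ∀ (k : ℕ) (r : ℝ), r ∈ Set.Icc (0 : ℝ) 1 →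
      ‖((Ring.choose α k : ℝ) : ℂ) * (r * x) ^ k‖ ≤ |Ring.choose α k| := fun k r hr ↦ by
    rw [norm_mul, Complex.norm_real, Real.norm_eq_abs, norm_pow, norm_mul, hx, mul_one,
      Complex.norm_real, Real.norm_of_nonneg hr.1]
    exact mul_le_of_le_one_right (abs_nonneg _) (pow_le_one₀ hr.1 hr.2)
  have hcont : ContinuousOn (fun r : ℝ ↦ ∑' k, ((Ring.choose α k : ℝ) : ℂ) * (r * x) ^ k)
      (Set.Icc 0 1) :=
    continuousOn_tsum (fun k ↦ by fun_prop) (summable_abs_choose hα) hbound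
  have heq : ∀ r ∈ Set.Ico (0 : ℝ) 1,
      ∑' k, ((Ring.choose α k : ℝ) : ℂ) * (r * x) ^ k = (1 + r * x) ^ (α : ℂ) := fun r hr ↦ by
    have h := (Complex.one_add_cpow_hasFPowerSeriesOnBall_zero (a := (α : ℂ))).hasSum
      (y := r * x) (by
        have : ‖(r * x : ℂ)‖ < 1 := by
          rw [norm_mul, hx, mul_one, Complex.norm_real, Real.norm_of_nonneg hr.1]
          exact hr.2
        rw [Metric.mem_eball, edist_zero_right, ← ofReal_norm]
        exact ENNReal.ofReal_lt_one.2 this)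
    simp only [binomialSeries_apply, List.ofFn_const, List.prod_replicate, zero_add,
      smul_eq_mul] at h
    simp only [← h.tsum_eq, Complex.ofReal_choose]
  have hne : (𝓝[Set.Ico (0 : ℝ) 1] 1).NeBot := by
    rw [← mem_closure_iff_nhdsWithin_neBot, closure_Ico zero_ne_one]
    simp
  have h1 := (hcont 1 (by simp)).mono_left (nhdsWithin_mono _ Set.Ico_subset_Icc_self)
  have h2 : Tendsto (fun r : ℝ ↦ (1 + r * x) ^ (α : ℂ)) (𝓝[Set.Ico (0 : ℝ) 1] 1)
      (𝓝 ((1 + (1 : ℝ) * x) ^ (α : ℂ))) := by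
    refine (ContinuousAt.cpow (by fun_prop) continuousAt_const ?_).continuousWithinAt
    simpa using hx1
  -- Abel's limit argument: both sides are continuous along the radius as `r → 1`.
  have h3 := tendsto_nhds_unique (h1.congr' (eventually_mem_nhdsWithin.mono heq)) h2
  simp only [Complex.ofReal_one, one_mul] at h3
  rw [← h3]
  refine (Summable.of_norm_bounded (summable_abs_choose hα) fun k ↦ ?_).hasSum
  simpa using hbound k 1 (by simp)

/-! ### The tail as an integral. -/

/-- The density whose moments are the numbers `absChoose α (k + 2)`. -/
noncomputable def betaWeight (α t : ℝ) : ℝ :=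
  Real.sin (Real.pi * α) / Real.pi * (t ^ (1 - α) * (1 - t) ^ α)

theorem continuous_betaWeight {α : ℝ} (hα : α ∈ Set.Ioo (0 : ℝ) 1) :
    Continuous (betaWeight α) := by
  have h1 : Continuous fun t : ℝ ↦ t ^ (1 - α) :=
    continuous_id.rpow_const fun _ ↦ Or.inr (by linarith [hα.2])
  have h2 : Continuous fun t : ℝ ↦ (1 - t) ^ α :=
    (continuous_const.sub continuous_id).rpow_const fun _ ↦ Or.inr hα.1.le
  unfold betaWeight
  fun_prop

theorem sin_pi_mul_pos {α : ℝ} (hα : α ∈ Set.Ioo (0 : ℝ) 1) : 0 < Real.sin (Real.pi * α) :=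
  Real.sin_pos_of_pos_of_lt_pi (mul_pos Real.pi_pos hα.1)
    (mul_lt_of_lt_one_right Real.pi_pos hα.2)

theorem betaWeight_nonneg {α t : ℝ} (hα : α ∈ Set.Ioo (0 : ℝ) 1) (ht : t ∈ Set.Icc (0 : ℝ) 1) :
    0 ≤ betaWeight α t := by
  have := sin_pi_mul_pos hα
  have := Real.pi_pos
  have := Real.rpow_nonneg ht.1 (1 - α)
  have := Real.rpow_nonneg (sub_nonneg.2 ht.2) α
  unfold betaWeight
  positivity

theorem integral_rpow_mul_one_sub_rpow {a b : ℝ} (ha : 0 < a) (hb : 0 < b) :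
    ∫ t in (0 : ℝ)..1, t ^ (a - 1) * (1 - t) ^ (b - 1) = ProbabilityTheory.beta a b := by
  rw [ProbabilityTheory.beta_eq_betaIntegralReal a b ha hb, Complex.betaIntegral]
  have h : ∫ t in (0 : ℝ)..1, (t : ℂ) ^ ((a : ℂ) - 1) * (1 - (t : ℂ)) ^ ((b : ℂ) - 1) =
      ∫ t in (0 : ℝ)..1, ((t ^ (a - 1) * (1 - t) ^ (b - 1) : ℝ) : ℂ) := by
    refine intervalIntegral.integral_congr fun t ht ↦ ?_
    rw [Set.uIcc_of_le zero_le_one] at ht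
    have h1 : 0 ≤ 1 - t := sub_nonneg.2 ht.2
    rw [Complex.ofReal_mul, Complex.ofReal_cpow ht.1, Complex.ofReal_cpow h1]
    push_cast
    rfl
  rw [h, intervalIntegral.integral_ofReal, Complex.ofReal_re]

/-- A beta integral. Reflection for `Γ` gives the first coefficient, `α`, and `Γ(s + 1) = s Γ(s)`
reproduces the recursion of `absChoose`. Starting the moments at index 2 keeps the weight continuous
at `0`. -/
theorem integral_pow_mul_betaWeight {α : ℝ} (hα : α ∈ Set.Ioo (0 : ℝ) 1) (k : ℕ) :
    ∫ t in (0 : ℝ)..1, t ^ k * betaWeight α t = absChoose α (k + 2) := by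
  have hα0 := hα.1
  have hα1 := hα.2
  have hbeta : ∀ k : ℕ, Real.sin (Real.pi * α) / Real.pi *
      ProbabilityTheory.beta (k + 1 - α) (1 + α) = absChoose α (k + 1) := fun k ↦ by
    unfold ProbabilityTheory.beta
    induction k with
    | zero =>
      have h := Real.Gamma_mul_Gamma_one_sub α
      have hs := (sin_pi_mul_pos hα).ne'
      have hp := Real.pi_ne_zero
      rw [eq_div_iff hs] at h
      rw [absChoose_one, add_comm 1 α, Real.Gamma_add_one hα0.ne',
        show ((0 : ℕ) : ℝ) + 1 - α + (α + 1) = 2 by push_cast; ring, Real.Gamma_two]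
      simp only [Nat.cast_zero, zero_add]
      field_simp
      linear_combination h
    | succ k ih =>
      have hk : (0 : ℝ) < k + 1 - α := by linarith [(Nat.cast_nonneg k : (0 : ℝ) ≤ k)]
      have h1 := Real.Gamma_add_one hk.ne'
      have h2 := Real.Gamma_add_one (s := k + 1 - α + (1 + α)) (by positivity)
      have h3 := succ_mul_absChoose_succ α (k + 1)
      push_cast at h3 ⊢
      rw [show (k : ℝ) + 1 + 1 - α = k + 1 - α + 1 by ring, h1,
        show (k : ℝ) + 1 - α + 1 + (1 + α) = k + 1 - α + (1 + α) + 1 by ring, h2]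
      have hk2 : (k : ℝ) + 1 + 1 ≠ 0 := by positivity
      apply mul_left_cancel₀ hk2
      rw [h3, ← ih]
      have h4 : (k : ℝ) + 1 - α + (1 + α) ≠ 0 := by positivity
      have h5 := (Real.Gamma_pos_of_pos (show (0 : ℝ) < k + 1 - α + (1 + α) by positivity)).ne'
      field_simp
      ring
  rw [← hbeta (k + 1), ← integral_rpow_mul_one_sub_rpow _ (by linarith),
    ← intervalIntegral.integral_const_mul]
  · refine intervalIntegral.integral_congr fun t ht ↦ ?_
    rw [Set.uIcc_of_le zero_le_one] at ht
    unfold betaWeight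
    rw [show ((k + 1 : ℕ) : ℝ) + 1 - α - 1 = k + (1 - α) by push_cast; ring,
      Real.rpow_add_of_nonneg ht.1 (by positivity) (by linarith), Real.rpow_natCast,
      add_sub_cancel_left]
    ring
  · push_cast
    linarith [(Nat.cast_nonneg k : (0 : ℝ) ≤ k)]

theorem hasSum_absChoose_mul_pow {α : ℝ} (hα : α ∈ Set.Ioo (0 : ℝ) 1) (p : ℕ) {w : ℂ}
    (hw : ‖w‖ = 1) :
    HasSum (fun k ↦ (absChoose α (p + 2 + k) : ℂ) * w ^ k)
      (∫ t in (0 : ℝ)..1, ((betaWeight α t * t ^ p : ℝ) : ℂ) * (1 - t * w)⁻¹) := by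
  have hW := continuous_betaWeight hα
  have hmom : ∀ k : ℕ, ∫ t in Set.Ioo (0 : ℝ) 1, t ^ (p + k) * betaWeight α t =
      absChoose α (p + 2 + k) := fun k ↦ by
    rw [show p + 2 + k = p + k + 2 by ring, ← integral_pow_mul_betaWeight hα,
      intervalIntegral.integral_of_le zero_le_one, integral_Ioc_eq_integral_Ioo]
  have h := hasSum_integral_of_summable_integral_norm (μ := volume.restrict (Set.Ioo (0 : ℝ) 1))
    (F := fun (k : ℕ) (t : ℝ) ↦ ((t ^ (p + k) * betaWeight α t : ℝ) : ℂ) * w ^ k)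
    (fun k ↦ by
      have : Continuous fun t : ℝ ↦ ((t ^ (p + k) * betaWeight α t : ℝ) : ℂ) * w ^ k := by
        fun_prop
      exact (this.integrableOn_Icc (a := 0) (b := 1)).mono_set Set.Ioo_subset_Icc_self)
    (by
      refine ((summable_nat_add_iff (p + 2)).2 (summable_absChoose hα)).congr fun k ↦ ?_
      rw [add_comm k, ← hmom k]
      refine setIntegral_congr_fun measurableSet_Ioo fun t ht ↦ ?_
      have h1 := betaWeight_nonneg hα (Set.Ioo_subset_Icc_self ht)
      have h2 := pow_nonneg ht.1.le (p + k)
      rw [norm_mul, norm_pow, hw, one_pow, mul_one, Complex.norm_real, Real.norm_of_nonneg]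
      positivity)
  have hterm : ∀ k : ℕ, ∫ t in Set.Ioo (0 : ℝ) 1,
      ((t ^ (p + k) * betaWeight α t : ℝ) : ℂ) * w ^ k = (absChoose α (p + 2 + k) : ℂ) * w ^ k :=
    fun k ↦ by rw [integral_mul_const, integral_complex_ofReal, hmom]
  simp only [hterm] at h
  convert! h using 1
  · rw [intervalIntegral.integral_of_le zero_le_one, integral_Ioc_eq_integral_Ioo]
    refine setIntegral_congr_fun measurableSet_Ioo fun t ht ↦ ?_
    have hn : ‖(t * w : ℂ)‖ < 1 := by
      rw [norm_mul, hw, mul_one, Complex.norm_real, Real.norm_of_nonneg ht.1.le]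
      exact ht.2
    rw [← tsum_geometric_of_norm_lt_one hn, ← tsum_mul_left]
    refine tsum_congr fun k ↦ ?_
    push_cast
    ring

/-! ### Maclaurin coefficients as partial sums, and their integral formula. -/

theorem iteratedDeriv_one_add_mul_cpow (α : ℝ) (x : ℂ) (k : ℕ) :
    iteratedDeriv k (fun z : ℂ ↦ (1 + x * z) ^ (α : ℂ)) 0 =
      (k.factorial : ℂ) * (((Ring.choose α k : ℝ) : ℂ) * x ^ k) := by
  have h0 : HasFPowerSeriesAt (fun z : ℂ ↦ (1 + z) ^ (α : ℂ)) (binomialSeries ℂ (α : ℂ))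
      ((x • ContinuousLinearMap.id ℂ ℂ) 0) := by
    simpa using Complex.one_add_cpow_hasFPowerSeriesAt_zero (a := (α : ℂ))
  obtain ⟨r, hr⟩ := h0.compContinuousLinearMap
  have h := hr.factorial_smul 1 k
  rw [iteratedDeriv_eq_iteratedFDeriv]
  have h2 : (fun z : ℂ ↦ (1 + x * z) ^ (α : ℂ)) =
      (fun z : ℂ ↦ (1 + z) ^ (α : ℂ)) ∘ (x • ContinuousLinearMap.id ℂ ℂ) := by
    ext z; simp
  rw [h2, ← h, FormalMultilinearSeries.compContinuousLinearMap_apply, nsmul_eq_mul]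
  simp only [Function.comp_def, binomialSeries_apply]
  simp [List.prod_replicate, Complex.ofReal_choose]

theorem iteratedDeriv_one_sub_inv (k : ℕ) :
    iteratedDeriv k (fun z : ℂ ↦ ((1 - z) ^ ((1 : ℝ) : ℂ))⁻¹) 0 = k.factorial := by
  have h := Complex.one_div_one_sub_hasFPowerSeriesOnBall_zero.factorial_smul 1 k
  rw [iteratedDeriv_eq_iteratedFDeriv]
  simp only [one_div] at h
  simp only [Complex.ofReal_one, Complex.cpow_one]
  rw [← h]
  simp

theorem brannanCoeff_one_right (m : ℕ) (α : ℝ) (x : ℂ) :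
    brannanCoeff m α 1 x = ∑ k ∈ Finset.range (m + 1), ((Ring.choose α k : ℝ) : ℂ) * x ^ k := by
  have hf : ContDiffAt ℂ m (fun z : ℂ ↦ (1 + x * z) ^ (α : ℂ)) 0 := by
    refine AnalyticAt.contDiffAt (AnalyticAt.cpow (by fun_prop) analyticAt_const ?_)
    simp
  have hg : ContDiffAt ℂ m (fun z : ℂ ↦ ((1 - z) ^ ((1 : ℝ) : ℂ))⁻¹) 0 := by
    simp only [Complex.ofReal_one, Complex.cpow_one]
    exact ContDiffAt.inv (by fun_prop) (by simp)
  have h : brannanFun α 1 x = (fun z : ℂ ↦ (1 + x * z) ^ (α : ℂ)) *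
      fun z : ℂ ↦ ((1 - z) ^ ((1 : ℝ) : ℂ))⁻¹ := by
    ext z
    simp [brannanFun, div_eq_mul_inv]
  rw [brannanCoeff, h, iteratedDeriv_mul hf hg, Finset.sum_div]
  refine Finset.sum_congr rfl fun k hk ↦ ?_
  rw [iteratedDeriv_one_add_mul_cpow, iteratedDeriv_one_sub_inv]
  have hk' : k ≤ m := Nat.lt_succ_iff.1 (Finset.mem_range.1 hk)
  have hm : (m.factorial : ℂ) ≠ 0 := by exact_mod_cast m.factorial_ne_zero
  have hc : (m.choose k : ℂ) * k.factorial * (m - k).factorial = m.factorial := by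
    exact_mod_cast Nat.choose_mul_factorial_mul_factorial hk'
  rw [div_eq_iff hm, ← hc]
  ring

theorem brannanCoeff_eq_cpow_add_integral {α : ℝ} (hα : α ∈ Set.Ioo (0 : ℝ) 1) (p : ℕ) {x : ℂ}
    (hx : ‖x‖ = 1) (hx1 : 1 + x ∈ Complex.slitPlane) :
    brannanCoeff (p + 1) α 1 x = (1 + x) ^ (α : ℂ) + (-x) ^ (p + 2) *
      ∫ t in (0 : ℝ)..1, ((betaWeight α t * t ^ p : ℝ) : ℂ) * (1 + t * x)⁻¹ := by
  have h := (hasSum_nat_add_iff' (p + 2)).2 (hasSum_choose_mul_pow_of_norm_eq_one hα hx hx1)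
  have h2 := (hasSum_absChoose_mul_pow hα p (w := -x) (by rwa [norm_neg])).mul_left
    (-(-x) ^ (p + 2))
  have h3 : (fun k ↦ -(-x) ^ (p + 2) * ((absChoose α (p + 2 + k) : ℂ) * (-x) ^ k)) =
      fun k ↦ ((Ring.choose α (k + (p + 2)) : ℝ) : ℂ) * x ^ (k + (p + 2)) := by
    funext k
    rw [choose_eq_absChoose, add_comm k]
    push_cast
    rw [neg_pow x (p + 2), neg_pow x k]
    ring
  rw [h3] at h2
  have h4 := h.unique h2
  rw [brannanCoeff_one_right]
  simp only [mul_neg, sub_neg_eq_add] at h4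
  linear_combination -h4

/-! ### Comparison with the value at `x = 1`. -/

theorem norm_one_add_real_mul {x : ℂ} (hx : ‖x‖ = 1) (t : ℝ) :
    ‖1 + t * x‖ = √(chordSq (‖1 + x‖ / 2) t) := by
  have hx2 : x.re ^ 2 + x.im ^ 2 = 1 := by
    have h := Complex.sq_norm x
    rw [hx, Complex.normSq_apply] at h
    linarith
  have h1 : ‖1 + x‖ ^ 2 = 2 + 2 * x.re := by
    rw [Complex.sq_norm, Complex.normSq_apply]
    simp only [Complex.add_re, Complex.one_re, Complex.add_im, Complex.one_im]
    linear_combination hx2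
  have h2 : chordSq (‖1 + x‖ / 2) t = ‖1 + t * x‖ ^ 2 := by
    rw [chordSq, div_pow, h1, Complex.sq_norm, Complex.normSq_apply]
    simp only [Complex.add_re, Complex.one_re, Complex.add_im, Complex.one_im,
      Complex.re_ofReal_mul, Complex.im_ofReal_mul]
    linear_combination -t ^ 2 * hx2
  rw [h2, Real.sqrt_sq (norm_nonneg _)]

theorem one_add_mem_slitPlane {x : ℂ} (hx : ‖x‖ = 1) (hne : x ≠ -1) :
    1 + x ∈ Complex.slitPlane := by
  refine Or.inl ?_
  have hx2 : x.re ^ 2 + x.im ^ 2 = 1 := by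
    have h := Complex.sq_norm x
    rw [hx, Complex.normSq_apply] at h
    linarith
  by_contra h
  simp only [Complex.add_re, Complex.one_re, not_lt] at h
  have him : x.im = 0 := by
    have : x.im ^ 2 ≤ 0 := by nlinarith
    exact pow_eq_zero_iff two_ne_zero |>.1 (this.antisymm (sq_nonneg _))
  have hre : x.re = -1 := by
    rw [him] at hx2
    nlinarith
  exact hne (Complex.ext (by simpa using hre) (by simpa using him))

theorem brannanCoeff_at_one {α : ℝ} (hα : α ∈ Set.Ioo (0 : ℝ) 1) {p : ℕ} (hp : Even p) :
    brannanCoeff (p + 1) α 1 1 =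
      ((2 ^ α + ∫ t in (0 : ℝ)..1, betaWeight α t * t ^ p * (1 + t)⁻¹ : ℝ) : ℂ) := by
  rw [brannanCoeff_eq_cpow_add_integral hα p norm_one
    (one_add_mem_slitPlane norm_one (by norm_num)), (hp.add even_two).neg_one_pow]
  push_cast
  rw [Complex.ofReal_cpow zero_le_two, ← intervalIntegral.integral_ofReal, one_mul]
  congr 1
  · norm_num
  · refine intervalIntegral.integral_congr fun t _ ↦ ?_
    push_cast
    rw [mul_one]

theorem integral_betaWeight_chord_le {α c : ℝ} (hα : α ∈ Set.Ioo (0 : ℝ) 1)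
    (hc : c ∈ Set.Ioc (0 : ℝ) 1) (p : ℕ) :
    (2 * c) ^ α + ∫ t in (0 : ℝ)..1, betaWeight α t * t ^ p * (√(chordSq c t))⁻¹ ≤
      2 ^ α + ∫ t in (0 : ℝ)..1, betaWeight α t * t ^ p * (1 + t)⁻¹ := by
  have hW := continuous_betaWeight hα
  have hD := continuous_chordSq c
  have c1 : ContinuousOn (fun t ↦ (√(chordSq c t))⁻¹) (Set.Icc 0 1) :=
    ContinuousOn.inv₀ (by fun_prop) fun t ht ↦ (Real.sqrt_pos.2 (chordSq_pos hc.1 ht.1)).ne'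
  have c2 : ContinuousOn (fun t : ℝ ↦ (1 + t)⁻¹) (Set.Icc 0 1) :=
    ContinuousOn.inv₀ (by fun_prop) fun t ht ↦ by linarith [ht.1]
  have hi : ∀ f : ℝ → ℝ, ContinuousOn f (Set.Icc 0 1) → IntervalIntegrable f volume 0 1 :=
    fun f hf ↦ ContinuousOn.intervalIntegrable (by rwa [Set.uIcc_of_le zero_le_one])
  have hB : Continuous fun t ↦ betaWeight α t * t ^ p := by fun_prop
  have hdiff : (∫ t in (0 : ℝ)..1, betaWeight α t * t ^ p * (√(chordSq c t))⁻¹) -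
      ∫ t in (0 : ℝ)..1, betaWeight α t * t ^ p * (1 + t)⁻¹ ≤
      ∫ t in (0 : ℝ)..1, betaWeight α t * ((√(chordSq c t))⁻¹ - (1 + t)⁻¹) := by
    have i1 : IntervalIntegrable (fun t ↦ betaWeight α t * t ^ p * (√(chordSq c t))⁻¹)
        volume 0 1 := hi _ (hB.continuousOn.mul c1)
    have i2 : IntervalIntegrable (fun t ↦ betaWeight α t * t ^ p * (1 + t)⁻¹) volume 0 1 :=
      hi _ (hB.continuousOn.mul c2)
    rw [← intervalIntegral.integral_sub i1 i2]
    refine intervalIntegral.integral_mono_on zero_le_one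
      (i1.sub i2)
      (hi _ (hW.continuousOn.mul (c1.sub c2))) fun t ht ↦ ?_
    rw [← mul_sub]
    refine mul_le_mul_of_nonneg_right
      (mul_le_of_le_one_right (betaWeight_nonneg hα ht) (pow_le_one₀ ht.1 ht.2)) ?_
    refine sub_nonneg.2 (inv_anti₀ (Real.sqrt_pos.2 (chordSq_pos hc.1 ht.1)) ?_)
    refine Real.sqrt_le_iff.2 ⟨by linarith [ht.1], ?_⟩
    unfold chordSq
    nlinarith [mul_nonneg ht.1 (mul_nonneg (sub_nonneg.2 hc.2) (by linarith [hc.1] : 0 ≤ 1 + c))]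
  have hweight : ∫ t in (0 : ℝ)..1, betaWeight α t * ((√(chordSq c t))⁻¹ - (1 + t)⁻¹) =
      Real.sin (Real.pi * α) / Real.pi *
        ∫ t in (0 : ℝ)..1, t ^ (1 - α) * (1 - t) ^ α * ((√(chordSq c t))⁻¹ - (1 + t)⁻¹) := by
    rw [← intervalIntegral.integral_const_mul]
    refine intervalIntegral.integral_congr fun t _ ↦ ?_
    simp only [betaWeight]
    ring
  have hk := integral_beta_chord_le hα hc
  have hsin : Real.sin (Real.pi * α) / Real.pi ≤ α := by
    rw [div_le_iff₀ Real.pi_pos, mul_comm α]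
    exact Real.sin_le (mul_pos Real.pi_pos hα.1).le
  have hs0 : 0 < Real.sin (Real.pi * α) / Real.pi := div_pos (sin_pi_mul_pos hα) Real.pi_pos
  have hr : 0 ≤ 2 ^ α * (1 - c ^ α) :=
    mul_nonneg (by positivity) (sub_nonneg.2 (Real.rpow_le_one hc.1.le hc.2 hα.1.le))
  have hfin : ∫ t in (0 : ℝ)..1, betaWeight α t * ((√(chordSq c t))⁻¹ - (1 + t)⁻¹) ≤
      2 ^ α * (1 - c ^ α) := by
    rw [hweight]
    set I := ∫ t in (0 : ℝ)..1, t ^ (1 - α) * (1 - t) ^ α * ((√(chordSq c t))⁻¹ - (1 + t)⁻¹)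
    -- Replacing `sin(πα)/π` by `α` needs `0 ≤ I`; otherwise the left side is nonpositive and the
    -- right side is not negative.
    rcases le_total 0 I with hI | hI
    · exact (mul_le_mul_of_nonneg_right hsin hI).trans hk
    · exact (mul_nonpos_of_nonneg_of_nonpos hs0.le hI).trans hr
  rw [Real.mul_rpow zero_le_two hc.1.le]
  linarith

/-- Parity plays no role here; it only identifies the bound with the coefficient at `x = 1`. The
point `x = -1`, where `1 + x` leaves the slit plane, is separate: there the coefficient lies in `[0,
1]` and `2^α ≥ 1`. -/
theorem norm_brannanCoeff_le {α : ℝ} (hα : α ∈ Set.Ioo (0 : ℝ) 1) {x : ℂ} (hx : ‖x‖ = 1) (p : ℕ) :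
    ‖brannanCoeff (p + 1) α 1 x‖ ≤
      2 ^ α + ∫ t in (0 : ℝ)..1, betaWeight α t * t ^ p * (1 + t)⁻¹ := by
  by_cases hne : x = -1
  · subst hne
    obtain ⟨h0, h1⟩ := sum_alternating_choose_mem_Icc hα (p + 1)
    have hint : 0 ≤ ∫ t in (0 : ℝ)..1, betaWeight α t * t ^ p * (1 + t)⁻¹ :=
      intervalIntegral.integral_nonneg zero_le_one fun t ht ↦
        mul_nonneg (mul_nonneg (betaWeight_nonneg hα ht) (pow_nonneg ht.1 p))
          (inv_nonneg.2 (by linarith [ht.1]))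
    have h2 : (1 : ℝ) ≤ 2 ^ α := Real.one_le_rpow one_le_two hα.1.le
    have heq : brannanCoeff (p + 1) α 1 (-1) =
        ((∑ k ∈ Finset.range (p + 1 + 1), Ring.choose α k * (-1) ^ k : ℝ) : ℂ) := by
      rw [brannanCoeff_one_right, Complex.ofReal_sum]
      simp
    rw [heq, Complex.norm_real, Real.norm_of_nonneg h0]
    linarith
  · have hmem := one_add_mem_slitPlane hx hne
    have hpos : 0 < ‖1 + x‖ := norm_pos_iff.2 (Complex.slitPlane_ne_zero hmem)
    have hc : ‖1 + x‖ / 2 ∈ Set.Ioc (0 : ℝ) 1 := by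
      refine ⟨by positivity, ?_⟩
      have := norm_add_le 1 x
      rw [norm_one, hx] at this
      linarith
    refine le_trans ?_ (integral_betaWeight_chord_le hα hc p)
    rw [brannanCoeff_eq_cpow_add_integral hα p hx hmem]
    refine (norm_add_le _ _).trans (add_le_add ?_ ?_)
    · rw [Complex.norm_cpow_real, mul_div_cancel₀ _ two_ne_zero]
    · rw [norm_mul, norm_pow, norm_neg, hx, one_pow, one_mul]
      refine (intervalIntegral.norm_integral_le_integral_norm zero_le_one).trans_eq ?_
      refine intervalIntegral.integral_congr fun t ht ↦ ?_
      rw [Set.uIcc_of_le zero_le_one] at ht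
      rw [norm_mul, norm_inv, norm_one_add_real_mul hx, Complex.norm_real, Real.norm_of_nonneg
        (mul_nonneg (betaWeight_nonneg hα ht) (pow_nonneg ht.1 p))]

theorem corollary2 (x : ℂ) (hx : ‖x‖ = 1) (α : ℝ) (hα : α ∈ Set.Ioo (0 : ℝ) 1)
    (n : ℕ) (hn : 1 ≤ n) :
    (brannanCoeff (2 * n - 1) α 1 1).im = 0 ∧
      ‖brannanCoeff (2 * n - 1) α 1 x‖ ≤ (brannanCoeff (2 * n - 1) α 1 1).re := by
  have hm : 2 * n - 1 = 2 * (n - 1) + 1 := by omega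
  rw [hm, brannanCoeff_at_one hα (even_two_mul _)]
  exact ⟨Complex.ofReal_im _, by
    rw [Complex.ofReal_re]
    exact norm_brannanCoeff_le hα hx _⟩
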